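/- Let $\mathcal A$ be a unital $C^*$-algebra, let $\mathcal H$ be a complex Hilbert space, and let $S_{\mathcal H}(\mathcal A)$ be the set of unital completely positive (UCP) maps $\mathcal A\to\mathcal B(\mathcal H)$. A map $\phi\in S_{\mathcal H}(\mathcal A)$ is called $C^*$-extreme in $S_{\mathcal H}(\mathcal A)$ if, whenever $\phi(\cdot)=\sum_{i=1}^n T_i^*\phi_i(\cdot)T_i$ with $\phi_i\in S_{\mathcal H}(\mathcal A)$ and invertible $T_i\in\mathcal B(\mathcal H)$ satisfying $\sum_{i=1}^n T_i^*T_i=I_{\mathcal H}$, for each $i$ there is a unitary $U_i\in\mathcal B(\mathcal H)$ with $\phi_i(\cdot)=U_i^*\phi(\cdot)U_i$. Let $\phi\in S_{\mathcal H}(\mathcal A)$ have minimal Stinespring triple $(\pi,V,\mathcal H_\pi)$; that is, $\mathcal H_\pi$ is a Hilbert space, $\pi:\mathcal A\to\mathcal B(\mathcal H_\pi)$ is a unital $*$-homomorphism, $V\in\mathcal B(\mathcal H,\mathcal H_\pi)$, $\phi(a)=V^*\pi(a)V$ for all $a\in\mathcal A$, and $\mathcal H_\pi$ is the closed linear span of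 $\pi(\mathcal A)V\mathcal H$. Let $\pi(\mathcal A)'$ be the commutant of $\pi(\mathcal A)$ in $\mathcal B(\mathcal H_\pi)$. Then $\phi$ is $C^*$-extreme in $S_{\mathcal H}(\mathcal A)$ if and only if for every positive operator $D\in\pi(\mathcal A)'$ with $V^*DV$ invertible there exists $S\in\pi(\mathcal A)'$ such that $$D=S^*S,\qquad SVV^*=VV^*SVV^*,\qquad V^*SV \text{ is invertible.}$$ Moreover, for $S\in\pi(\mathcal A)'$, the last two conditions hold if and only if $S(V\mathcal H)\subseteq V\mathcal H$ and the restriction $S|_{V\mathcal H}$ is invertible as a bounded operator on $V\mathcal H$. -/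

import Mathlib

open scoped CStarAlgebra

/-- The generalized state space `S_H(A)`: all unital completely positive maps `A → B(H)`. -/
def generalizedStateSpace (A : Type*) [CStarAlgebra A] [PartialOrder A] [StarOrderedRing A]
    (H : Type*) [NormedAddCommGroup H] [InnerProductSpace ℂ H] [CompleteSpace H] :
    Set (A →CP (H →L[ℂ] H)) :=
  {φ | φ 1 = 1}

/-- `φ(·) = ∑ᵢ Tᵢ* ψᵢ(·) Tᵢ` is a proper C⋆-convex combination: the `ψᵢ` are UCP maps, the
coefficients `Tᵢ` are invertible in `B(H)`, and `∑ᵢ Tᵢ* Tᵢ = I`. -/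
structure IsProperCStarConvexCombination
    {A : Type*} [CStarAlgebra A] [PartialOrder A] [StarOrderedRing A]
    {H : Type*} [NormedAddCommGroup H] [InnerProductSpace ℂ H] [CompleteSpace H]
    (φ : A →CP (H →L[ℂ] H)) {n : ℕ} (T : Fin n → (H →L[ℂ] H))
    (ψ : Fin n → (A →CP (H →L[ℂ] H))) : Prop where
  ucp : ∀ i, ψ i ∈ generalizedStateSpace A H
  invertible : ∀ i, IsUnit (T i)
  sum_coeff : ∑ i, star (T i) * T i = 1
  eq_sum : ∀ a, φ a = ∑ i, star (T i) * ψ i a * T i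

/-- `ψ = U* φ(·) U` for some unitary `U ∈ B(H)`. -/
def IsUnitarilyEquivalentTo
    {A : Type*} [CStarAlgebra A] [PartialOrder A] [StarOrderedRing A]
    {H : Type*} [NormedAddCommGroup H] [InnerProductSpace ℂ H] [CompleteSpace H]
    (ψ φ : A →CP (H →L[ℂ] H)) : Prop :=
  ∃ U ∈ unitary (H →L[ℂ] H), ∀ a, ψ a = star U * φ a * U

/-- `φ` is a C⋆-extreme point of the generalized state space `S_H(A)`. -/
def IsCStarExtreme
    {A : Type*} [CStarAlgebra A] [PartialOrder A] [StarOrderedRing A]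
    {H : Type*} [NormedAddCommGroup H] [InnerProductSpace ℂ H] [CompleteSpace H]
    (φ : A →CP (H →L[ℂ] H)) : Prop :=
  φ ∈ generalizedStateSpace A H ∧
    ∀ (n : ℕ) (T : Fin n → (H →L[ℂ] H)) (ψ : Fin n → (A →CP (H →L[ℂ] H))),
      IsProperCStarConvexCombination φ T ψ → ∀ i, IsUnitarilyEquivalentTo (ψ i) φ

/-- `(π, V, K)` is a minimal Stinespring triple for `φ`: `φ(a) = V* π(a) V` for all `a`, and `K`
is the closed linear span of `π(A) V H`. -/
structure IsMinimalStinespring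
    {A : Type*} [CStarAlgebra A] [PartialOrder A] [StarOrderedRing A]
    {H : Type*} [NormedAddCommGroup H] [InnerProductSpace ℂ H] [CompleteSpace H]
    {K : Type*} [NormedAddCommGroup K] [InnerProductSpace ℂ K] [CompleteSpace K]
    (φ : A →CP (H →L[ℂ] H)) (π : A →⋆ₐ[ℂ] (K →L[ℂ] K)) (V : H →L[ℂ] K) : Prop where
  dilation : ∀ a, φ a = V.adjoint ∘L π a ∘L V
  minimal : (Submodule.span ℂ {x : K | ∃ (a : A) (h : H), x = π a (V h)}).topologicalClosure = ⊤

/-- The commutant `π(A)'` in `B(K)`. -/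
def repCommutant {A : Type*} [CStarAlgebra A]
    {K : Type*} [NormedAddCommGroup K] [InnerProductSpace ℂ K] [CompleteSpace K]
    (π : A →⋆ₐ[ℂ] (K →L[ℂ] K)) : Set (K →L[ℂ] K) :=
  Set.centralizer (Set.range π)

/-- `S` maps the subspace `E` into itself and its restriction `S|_E : E → E` is invertible as a
bounded operator on `E`. -/
def IsInvertibleOn {K : Type*} [NormedAddCommGroup K] [InnerProductSpace ℂ K]
    (S : K →L[ℂ] K) (E : Submodule ℂ K) : Prop :=
  ∃ h : ∀ x ∈ E, S x ∈ E, IsUnit ((S ∘L E.subtypeL).codRestrict E fun x => h x x.2)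

open scoped InnerProductSpace

namespace CStarAlgebra

variable {B : Type*} [NonUnitalCStarAlgebra B] [PartialOrder B] [StarOrderedRing B]

lemma exists_eq_star_mul_self_of_nonneg {b : B} (hb : 0 ≤ b) : ∃ x : B, b = star x * x :=
  CStarAlgebra.nonneg_iff_eq_star_mul_self.mp hb

lemma exists_orthogonal_decomposition {b : B} (hb : IsSelfAdjoint b) :
    ∃ p x : B, 0 ≤ p ∧ b = p - star x * x ∧ p * (star x * x) = 0 := by
  obtain ⟨x, hx⟩ := exists_eq_star_mul_self_of_nonneg (CFC.negPart_nonneg b)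
  refine ⟨b⁺, x, CFC.posPart_nonneg b, ?_, ?_⟩
  · rw [← hx, CFC.posPart_sub_negPart b hb]
  · rw [← hx, CFC.posPart_mul_negPart]

end CStarAlgebra

namespace CStarMatrix

section

variable {n : Type*} [Fintype n] {H : Type*} [NormedAddCommGroup H] [InnerProductSpace ℂ H]

/-- The action of a matrix of operators on a tuple of vectors. -/
def opMulVec (M : CStarMatrix n n (H →L[ℂ] H)) (h : n → H) (i : n) : H :=
  ∑ j, M i j (h j)

lemma opMulVec_mul (M N : CStarMatrix n n (H →L[ℂ] H)) (h : n → H) :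
    opMulVec (M * N) h = opMulVec M (opMulVec N h) := by
  ext i
  simp only [opMulVec, mul_apply, _root_.sum_apply, map_sum,
    mul_apply_eq_comp]
  rw [Finset.sum_comm]

lemma opMulVec_sub (M N : CStarMatrix n n (H →L[ℂ] H)) (h : n → H) (i : n) :
    opMulVec (M - N) h i = opMulVec M h i - opMulVec N h i := by
  simp [opMulVec, Finset.sum_sub_distrib]

lemma opMulVec_zero (h : n → H) (i : n) :
    opMulVec (0 : CStarMatrix n n (H →L[ℂ] H)) h i = 0 := by
  simp [opMulVec]

lemma eq_zero_of_opMulVec [DecidableEq n] {M : CStarMatrix n n (H →L[ℂ] H)}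
    (hM : ∀ h i, opMulVec M h i = 0) : M = 0 := by
  ext i j x
  have h := hM (Pi.single j x) i
  rw [opMulVec, Finset.sum_eq_single j] at h
  · simpa using h
  · intro k _ hk
    simp [hk]
  · simp

end

variable {n : Type*} [Fintype n]
  {H : Type*} [NormedAddCommGroup H] [InnerProductSpace ℂ H] [CompleteSpace H]

lemma sum_inner_opMulVec_star (M : CStarMatrix n n (H →L[ℂ] H)) (g h : n → H) :
    ∑ i, ⟪g i, opMulVec (star M) h i⟫_ℂ = ∑ i, ⟪opMulVec M g i, h i⟫_ℂ := by
  simp only [opMulVec, inner_sum, sum_inner, star_apply, ContinuousLinearMap.star_eq_adjoint,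
    ContinuousLinearMap.adjoint_inner_right]
  rw [Finset.sum_comm]

lemma re_sum_inner_opMulVec_star_mul_self (M : CStarMatrix n n (H →L[ℂ] H)) (h : n → H) :
    (∑ i, ⟪h i, opMulVec (star M * M) h i⟫_ℂ).re = ∑ i, ‖opMulVec M h i‖ ^ 2 := by
  rw [opMulVec_mul, sum_inner_opMulVec_star, Complex.re_sum]
  exact Finset.sum_congr rfl fun i _ => inner_self_eq_norm_sq (𝕜 := ℂ) _

lemma re_sum_inner_opMulVec_nonneg {M : CStarMatrix n n (H →L[ℂ] H)} (hM : 0 ≤ M) (h : n → H) :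
    0 ≤ (∑ i, ⟪h i, opMulVec M h i⟫_ℂ).re := by
  classical
  obtain ⟨N, rfl⟩ := CStarAlgebra.exists_eq_star_mul_self_of_nonneg hM
  rw [re_sum_inner_opMulVec_star_mul_self]
  positivity

lemma nonneg_of_re_sum_inner_opMulVec_nonneg {M : CStarMatrix n n (H →L[ℂ] H)}
    (hsa : IsSelfAdjoint M) (hM : ∀ h, 0 ≤ (∑ i, ⟪h i, opMulVec M h i⟫_ℂ).re) : 0 ≤ M := by
  classical
  obtain ⟨P, Q, hP, hPQ, hmul⟩ := CStarAlgebra.exists_orthogonal_decomposition hsa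
  have hQN : Q * (star Q * Q) = 0 := by
    refine eq_zero_of_opMulVec fun h i => ?_
    have h1 := hM (opMulVec (star Q * Q) h)
    have h2 : ∀ i, opMulVec M (opMulVec (star Q * Q) h) i =
        - opMulVec (star Q * Q) (opMulVec (star Q * Q) h) i := by
      intro i
      rw [hPQ, opMulVec_sub, ← opMulVec_mul P, hmul, opMulVec_zero, zero_sub]
    simp only [h2, inner_neg_right, Finset.sum_neg_distrib, Complex.neg_re] at h1
    rw [re_sum_inner_opMulVec_star_mul_self] at h1
    have h4 : ∑ i, ‖opMulVec Q (opMulVec (star Q * Q) h) i‖ ^ 2 = 0 :=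
      le_antisymm (by linarith) (by positivity)
    rw [Finset.sum_eq_zero_iff_of_nonneg (fun _ _ => by positivity)] at h4
    rw [opMulVec_mul]
    simpa using h4 i (Finset.mem_univ i)
  have hNN : star (star Q * Q) * (star Q * Q) = 0 := by
    rw [star_mul, star_star, mul_assoc, hQN, mul_zero]
  rw [hPQ, (CStarRing.star_mul_self_eq_zero_iff _).mp hNN, sub_zero]
  exact hP

end CStarMatrix

section Compression

variable {A : Type*} [CStarAlgebra A] [PartialOrder A] [StarOrderedRing A]
  {H : Type*} [NormedAddCommGroup H] [InnerProductSpace ℂ H] [CompleteSpace H]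
  {K : Type*} [NormedAddCommGroup K] [InnerProductSpace ℂ K] [CompleteSpace K]

/-- The completely positive map `a ↦ R* π(a) R`. -/
noncomputable def compressionCP (π : A →⋆ₐ[ℂ] (K →L[ℂ] K)) (R : H →L[ℂ] K) :
    A →CP (H →L[ℂ] H) where
  toFun a := R.adjoint ∘L π a ∘L R
  map_add' a b := by ext; simp
  map_smul' c a := by ext; simp
  map_cstarMatrix_nonneg' k M hM := by
    obtain ⟨N, rfl⟩ := CStarAlgebra.exists_eq_star_mul_self_of_nonneg hM
    apply CStarMatrix.nonneg_of_re_sum_inner_opMulVec_nonneg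
    · rw [isSelfAdjoint_iff]
      ext i j : 2
      have h := CStarMatrix.star_apply_of_isSelfAdjoint (IsSelfAdjoint.star_mul_self N)
        (i := j) (j := i)
      simp only [CStarMatrix.star_apply, CStarMatrix.map_apply, LinearMap.coe_mk, AddHom.coe_mk]
      rw [← h, map_star]
      simp [ContinuousLinearMap.star_eq_adjoint, ContinuousLinearMap.adjoint_comp,
        ContinuousLinearMap.comp_assoc]
    · intro h
      have key : ∑ i, ⟪h i, CStarMatrix.opMulVec ((star N * N).map
          fun a => R.adjoint ∘L π a ∘L R) h i⟫_ℂ =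
          ∑ k, ⟪∑ j, π (N k j) (R (h j)), ∑ j, π (N k j) (R (h j))⟫_ℂ := by
        simp only [CStarMatrix.opMulVec, inner_sum, sum_inner, CStarMatrix.map_apply,
          CStarMatrix.mul_apply, CStarMatrix.star_apply, map_sum, map_mul, map_star,
          ContinuousLinearMap.comp_apply, ContinuousLinearMap.adjoint_inner_right,
          _root_.sum_apply, mul_apply_eq_comp,
          ContinuousLinearMap.star_eq_adjoint]
        rw [Finset.sum_comm_cycle]
        exact Finset.sum_congr rfl fun _ _ => Finset.sum_comm
      refine le_of_le_of_eq ?_ (congrArg Complex.re key.symm)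
      rw [Complex.re_sum]
      exact Finset.sum_nonneg fun k _ => inner_self_nonneg (𝕜 := ℂ)

lemma CompletelyPositiveMap.re_sum_inner_nonneg (ψ : A →CP (H →L[ℂ] H)) {n : Type*} [Fintype n]
    (a : n → A) (h : n → H) :
    0 ≤ (∑ i, ∑ j, ⟪h i, ψ (star (a i) * a j) (h j)⟫_ℂ).re := by
  classical
  rcases isEmpty_or_nonempty n with _ | ⟨⟨i₀⟩⟩
  · simp
  let N : CStarMatrix n n A := CStarMatrix.ofMatrix fun i j => if i = i₀ then a j else 0
  have h1 := CStarMatrix.re_sum_inner_opMulVec_nonneg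
    (ψ.map_cstarMatrix_nonneg _ (star_mul_self_nonneg N)) h
  have h2 : ∀ i j, (star N * N) i j = star (a i) * a j := by
    intro i j
    have hN : ∀ k l, N k l = if k = i₀ then a l else 0 := fun _ _ => rfl
    rw [CStarMatrix.mul_apply, Finset.sum_eq_single i₀]
    · simp [CStarMatrix.star_apply, hN]
    · intro k _ hk
      simp [hN, hk]
    · simp
  simpa [CStarMatrix.opMulVec, h2, inner_sum] using h1

end Compression

/-- A positive semidefinite form dominated by the norm of a map with dense range is given by a
positive bounded operator. -/
lemma exists_isPositive_of_core_le {E : Type*} [AddCommGroup E] [Module ℂ E]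
    {K : Type*} [NormedAddCommGroup K] [InnerProductSpace ℂ K] [CompleteSpace K]
    (c : PreInnerProductSpace.Core ℂ E) (L : E →ₗ[ℂ] K) (hL : DenseRange L)
    (hc : ∀ x, (c.inner x x).re ≤ ‖L x‖ ^ 2) :
    ∃ D : K →L[ℂ] K, D.IsPositive ∧ ∀ x y, ⟪L x, D (L y)⟫_ℂ = c.inner x y := by
  let _ : SeminormedAddCommGroup E := InnerProductSpace.Core.toSeminormedAddCommGroup (c := c)
  let _ : InnerProductSpace ℂ E := InnerProductSpace.ofCore c
  let ι : E →ₗ[ℂ] UniformSpace.Completion E := UniformSpace.Completion.toComplL.toLinearMap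
  have hι : ∀ x y, ⟪ι x, ι y⟫_ℂ = c.inner x y := fun x y =>
    UniformSpace.Completion.inner_coe x y
  have hbound : ∀ x, ‖ι x‖ ≤ 1 * ‖L x‖ := by
    intro x
    rw [one_mul, ← sq_le_sq₀ (norm_nonneg _) (norm_nonneg _)]
    refine le_trans (le_of_eq ?_) (hc x)
    rw [← hι]
    exact (inner_self_eq_norm_sq (𝕜 := ℂ) _).symm
  let J : K →L[ℂ] UniformSpace.Completion E := ι.extendOfNorm L
  have hJ : ∀ x, J (L x) = ι x := fun x => ι.extendOfNorm_eq hL ⟨1, hbound⟩ x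
  refine ⟨J.adjoint ∘L J, ContinuousLinearMap.isPositive_adjoint_comp_self J, fun x y => ?_⟩
  rw [ContinuousLinearMap.comp_apply, ContinuousLinearMap.adjoint_inner_right, hJ, hJ, hι]

section Orbit

variable {A : Type*} [CStarAlgebra A]
  {H : Type*} [NormedAddCommGroup H] [InnerProductSpace ℂ H]
  {K : Type*} [NormedAddCommGroup K] [InnerProductSpace ℂ K] [CompleteSpace K]

/-- The map `∑ aᵢ ⊗ xᵢ ↦ ∑ π(aᵢ) W xᵢ`. -/
noncomputable def orbitMap (π : A →⋆ₐ[ℂ] (K →L[ℂ] K)) (W : H →L[ℂ] K) : (A →₀ H) →ₗ[ℂ] K :=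
  Finsupp.lsum ℂ fun a => (π a ∘L W).toLinearMap

lemma orbitMap_apply (π : A →⋆ₐ[ℂ] (K →L[ℂ] K)) (W : H →L[ℂ] K) (f : A →₀ H) :
    orbitMap π W f = f.sum fun a x => π a (W x) := rfl

lemma orbitMap_single (π : A →⋆ₐ[ℂ] (K →L[ℂ] K)) (W : H →L[ℂ] K) (a : A) (x : H) :
    orbitMap π W (Finsupp.single a x) = π a (W x) := by
  simp [orbitMap_apply]

lemma orbitMap_lmapDomain (π : A →⋆ₐ[ℂ] (K →L[ℂ] K)) (W : H →L[ℂ] K) (b : A) (f : A →₀ H) :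
    orbitMap π W (Finsupp.lmapDomain H ℂ (b * ·) f) = π b (orbitMap π W f) := by
  induction f using Finsupp.induction_linear with
  | zero => simp
  | add f g hf hg => simp only [map_add, hf, hg]
  | single a x => simp [orbitMap_single, Finsupp.mapDomain_single]

/-- The form `⟨∑ aᵢ ⊗ xᵢ, ∑ bⱼ ⊗ yⱼ⟩ = ∑ ⟨xᵢ, θ(aᵢ* bⱼ) yⱼ⟩`. -/
noncomputable def kernelForm (θ : A → (H →L[ℂ] H)) (f g : A →₀ H) : ℂ :=
  f.sum fun a x => g.sum fun b y => ⟪x, θ (star a * b) y⟫_ℂ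

variable (θ : A → (H →L[ℂ] H))

lemma kernelForm_zero_left (g : A →₀ H) : kernelForm θ 0 g = 0 := by
  simp [kernelForm]

lemma kernelForm_zero_right (f : A →₀ H) : kernelForm θ f 0 = 0 := by
  simp [kernelForm]

lemma kernelForm_add_left (f f' g : A →₀ H) :
    kernelForm θ (f + f') g = kernelForm θ f g + kernelForm θ f' g := by
  refine Finsupp.sum_add_index' (fun a => by simp) fun a x x' => ?_
  simp only [inner_add_left, Finsupp.sum_add]

lemma kernelForm_add_right (f g g' : A →₀ H) :
    kernelForm θ f (g + g') = kernelForm θ f g + kernelForm θ f g' := by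
  rw [kernelForm, kernelForm, kernelForm, ← Finsupp.sum_add]
  congr 1
  ext a x
  exact Finsupp.sum_add_index' (fun a => by simp) fun a x x' => by simp

lemma kernelForm_single (a b : A) (x y : H) :
    kernelForm θ (Finsupp.single a x) (Finsupp.single b y) = ⟪x, θ (star a * b) y⟫_ℂ := by
  simp [kernelForm]

lemma kernelForm_smul_left (f g : A →₀ H) (c : ℂ) :
    kernelForm θ (c • f) g = (starRingEnd ℂ) c * kernelForm θ f g := by
  rw [kernelForm, kernelForm, Finsupp.sum_smul_index' (fun a => by simp)]
  simp only [inner_smul_left, Finsupp.sum, Finset.mul_sum]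

lemma kernelForm_lmapDomain (b : A) (f g : A →₀ H) :
    kernelForm θ f (Finsupp.lmapDomain H ℂ (b * ·) g) =
      kernelForm θ (Finsupp.lmapDomain H ℂ (star b * ·) f) g := by
  induction f using Finsupp.induction_linear with
  | zero => simp [kernelForm_zero_left]
  | add f f' hf hf' => simp only [kernelForm_add_left, map_add, hf, hf']
  | single a x =>
    induction g using Finsupp.induction_linear with
    | zero => simp [kernelForm_zero_right]
    | add f f' hf hf' => simp only [kernelForm_add_right, map_add, hf, hf']
    | single c y =>
      simp only [Finsupp.lmapDomain_apply, Finsupp.mapDomain_single, kernelForm_single, star_mul,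
        star_star, mul_assoc]

lemma kernelForm_sum {ι : Type*} (s : Finset ι) (θ : ι → A → (H →L[ℂ] H)) (f g : A →₀ H) :
    kernelForm (fun a => ∑ i ∈ s, θ i a) f g = ∑ i ∈ s, kernelForm (θ i) f g := by
  induction f using Finsupp.induction_linear with
  | zero => simp [kernelForm_zero_left]
  | add f f' hf hf' => simp only [kernelForm_add_left, hf, hf', Finset.sum_add_distrib]
  | single a x =>
    induction g using Finsupp.induction_linear with
    | zero => simp [kernelForm_zero_right]
    | add f f' hf hf' => simp only [kernelForm_add_right, hf, hf', Finset.sum_add_distrib]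
    | single c y => simp only [kernelForm_single, sum_apply, inner_sum]

lemma DenseRange.orbitMap_comp {π : A →⋆ₐ[ℂ] (K →L[ℂ] K)} {V : H →L[ℂ] K}
    (hV : DenseRange (orbitMap π V)) {U : H →L[ℂ] H} (hU : IsUnit U) :
    DenseRange (orbitMap π (V ∘L U)) := by
  obtain ⟨u, rfl⟩ := hU
  refine hV.mono ?_
  rintro _ ⟨f, rfl⟩
  refine ⟨Finsupp.mapRange.linearMap (↑u⁻¹ : H →L[ℂ] H).toLinearMap f, ?_⟩
  induction f using Finsupp.induction_linear with
  | zero => simp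
  | add f f' hf hf' => simp only [map_add, hf, hf']
  | single a x =>
    have : (u : H →L[ℂ] H) ((↑u⁻¹ : H →L[ℂ] H) x) = x := by
      rw [← mul_apply_eq_comp, u.mul_inv, one_apply_eq_self]
    simp [orbitMap_single, this]

lemma ContinuousLinearMap.ext_of_denseRange_orbitMap {π : A →⋆ₐ[ℂ] (K →L[ℂ] K)} {W : H →L[ℂ] K}
    (hW : DenseRange (orbitMap π W)) {F : Type*} [NormedAddCommGroup F] [NormedSpace ℂ F]
    {S T : K →L[ℂ] F} (h : ∀ a x, S (π a (W x)) = T (π a (W x))) : S = T := by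
  refine DFunLike.coe_injective (hW.equalizer S.continuous T.continuous (funext fun f => ?_))
  have : S.toLinearMap ∘ₗ orbitMap π W = T.toLinearMap ∘ₗ orbitMap π W := by
    ext a x
    simpa [orbitMap_single] using h a x
  exact congrArg (fun L => L f) this

variable [CompleteSpace H]

lemma kernelForm_conj_symm (hθ : ∀ a, (θ a).adjoint = θ (star a)) (f g : A →₀ H) :
    (starRingEnd ℂ) (kernelForm θ g f) = kernelForm θ f g := by
  induction f using Finsupp.induction_linear with
  | zero => simp [kernelForm_zero_left, kernelForm_zero_right]
  | add f f' hf hf' => simp only [kernelForm_add_left, kernelForm_add_right, map_add, hf, hf']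
  | single a x =>
    induction g using Finsupp.induction_linear with
    | zero => simp [kernelForm_zero_left, kernelForm_zero_right]
    | add f f' hf hf' => simp only [kernelForm_add_left, kernelForm_add_right, map_add, hf, hf']
    | single b y =>
      rw [kernelForm_single, kernelForm_single, inner_conj_symm,
        ← ContinuousLinearMap.adjoint_inner_right, hθ, star_mul, star_star]

lemma kernelForm_compression (π : A →⋆ₐ[ℂ] (K →L[ℂ] K)) (W : H →L[ℂ] K) (f g : A →₀ H) :
    kernelForm (fun a => W.adjoint ∘L π a ∘L W) f g = ⟪orbitMap π W f, orbitMap π W g⟫_ℂ := by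
  induction f using Finsupp.induction_linear with
  | zero => simp [kernelForm_zero_left]
  | add f f' hf hf' => simp only [kernelForm_add_left, hf, hf', map_add, inner_add_left]
  | single a x =>
    induction g using Finsupp.induction_linear with
    | zero => simp [kernelForm_zero_right]
    | add f f' hf hf' => simp only [kernelForm_add_right, hf, hf', map_add, inner_add_right]
    | single c y =>
      simp [kernelForm_single, orbitMap_single, ContinuousLinearMap.adjoint_inner_right,
        map_star, ContinuousLinearMap.star_eq_adjoint]

lemma mem_repCommutant_iff {π : A →⋆ₐ[ℂ] (K →L[ℂ] K)} {S : K →L[ℂ] K} :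
    S ∈ repCommutant π ↔ ∀ a x, π a (S x) = S (π a x) := by
  simp only [repCommutant, Set.mem_centralizer_iff, Set.forall_mem_range, ContinuousLinearMap.ext_iff,
    mul_apply_eq_comp]

lemma star_mem_repCommutant {π : A →⋆ₐ[ℂ] (K →L[ℂ] K)} {S : K →L[ℂ] K}
    (hS : S ∈ repCommutant π) : star S ∈ repCommutant π := by
  rw [repCommutant, Set.mem_centralizer_iff, Set.forall_mem_range] at hS ⊢
  intro a
  have h := congrArg star (hS (star a))
  simpa [map_star] using h.symm

/-- A Radon–Nikodym theorem: a kernel dominated by that of a cyclic compression is given by a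
positive operator in the commutant. -/
lemma exists_mem_repCommutant_of_kernelForm_le {π : A →⋆ₐ[ℂ] (K →L[ℂ] K)} {W : H →L[ℂ] K}
    (hW : DenseRange (orbitMap π W)) {θ : A → (H →L[ℂ] H)}
    (hθ : ∀ a, (θ a).adjoint = θ (star a)) (hpos : ∀ f, 0 ≤ (kernelForm θ f f).re)
    (hle : ∀ f, (kernelForm θ f f).re ≤ ‖orbitMap π W f‖ ^ 2) :
    ∃ D ∈ repCommutant π, D.IsPositive ∧ ∀ a, θ a = W.adjoint ∘L D ∘L π a ∘L W := by
  let c : PreInnerProductSpace.Core ℂ (A →₀ H) :=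
    { inner := kernelForm θ
      conj_inner_symm := kernelForm_conj_symm θ hθ
      re_inner_nonneg := hpos
      add_left := kernelForm_add_left θ
      smul_left := kernelForm_smul_left θ }
  obtain ⟨D, hD, hDL⟩ := exists_isPositive_of_core_le c (orbitMap π W) hW hle
  have hform : ∀ f g, ⟪orbitMap π W f, D (orbitMap π W g)⟫_ℂ = kernelForm θ f g := hDL
  refine ⟨D, ?_, hD, fun a => ?_⟩
  · rw [repCommutant, Set.mem_centralizer_iff, Set.forall_mem_range]
    intro b
    refine ContinuousLinearMap.ext_of_denseRange_orbitMap hW fun a x => ?_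
    refine Dense.eq_of_inner_right ℂ hW ?_
    rintro _ ⟨f, rfl⟩
    rw [← orbitMap_single, mul_apply_eq_comp, mul_apply_eq_comp, ← orbitMap_lmapDomain, hform,
      kernelForm_lmapDomain, ← hform, orbitMap_lmapDomain, map_star,
      ContinuousLinearMap.star_eq_adjoint, ContinuousLinearMap.adjoint_inner_left]
  · ext y
    refine ext_inner_left ℂ fun x => ?_
    have h := hform (Finsupp.single 1 x) (Finsupp.single a y)
    rw [kernelForm_single, orbitMap_single, orbitMap_single] at h
    simpa [ContinuousLinearMap.adjoint_inner_right] using h.symm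

/-- Two compressions of the same representation that agree are intertwined by an isometry in the
commutant, as soon as one of them is cyclic. -/
lemma exists_isometry_mem_repCommutant {π : A →⋆ₐ[ℂ] (K →L[ℂ] K)} {W R : H →L[ℂ] K}
    (hW : DenseRange (orbitMap π W))
    (h : ∀ a, R.adjoint ∘L π a ∘L R = W.adjoint ∘L π a ∘L W) :
    ∃ X ∈ repCommutant π, (∀ x, X.adjoint (X x) = x) ∧ X ∘L W = R := by
  have hinner : ∀ f g, ⟪orbitMap π R f, orbitMap π R g⟫_ℂ = ⟪orbitMap π W f, orbitMap π W g⟫_ℂ := by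
    intro f g
    rw [← kernelForm_compression, ← kernelForm_compression]
    simp only [h]
  have hbound : ∀ f, ‖orbitMap π R f‖ ≤ 1 * ‖orbitMap π W f‖ := by
    intro f
    rw [one_mul, @norm_eq_sqrt_re_inner ℂ, hinner, ← @norm_eq_sqrt_re_inner ℂ]
  let X : K →L[ℂ] K := (orbitMap π R).extendOfNorm (orbitMap π W)
  have hX : ∀ f, X (orbitMap π W f) = orbitMap π R f := fun f =>
    (orbitMap π R).extendOfNorm_eq hW ⟨1, hbound⟩ f
  have hX' : ∀ a x, X (π a (W x)) = π a (R x) := by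
    intro a x
    rw [← orbitMap_single, hX, orbitMap_single]
  refine ⟨X, ?_, fun x => ?_, ?_⟩
  · rw [repCommutant, Set.mem_centralizer_iff, Set.forall_mem_range]
    intro b
    refine ContinuousLinearMap.ext_of_denseRange_orbitMap hW fun a x => ?_
    have hmul : ∀ z, π b (π a z) = π (b * a) z := fun z => by rw [map_mul, mul_apply_eq_comp]
    rw [mul_apply_eq_comp, mul_apply_eq_comp, hX', hmul, hmul, hX']
  · have : X.adjoint ∘L X = ContinuousLinearMap.id ℂ K := by
      refine ContinuousLinearMap.ext_of_denseRange_orbitMap hW fun a x => ?_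
      refine Dense.eq_of_inner_right ℂ hW ?_
      rintro _ ⟨f, rfl⟩
      rw [← orbitMap_single, ContinuousLinearMap.comp_apply,
        ContinuousLinearMap.adjoint_inner_right, hX, hX, hinner, ContinuousLinearMap.id_apply]
    simpa using congrArg (fun T => T x) this
  · ext x
    simpa using hX' 1 x

end Orbit

section Stinespring

variable {A : Type*} [CStarAlgebra A] [PartialOrder A] [StarOrderedRing A]
  {H : Type*} [NormedAddCommGroup H] [InnerProductSpace ℂ H] [CompleteSpace H]
  {K : Type*} [NormedAddCommGroup K] [InnerProductSpace ℂ K] [CompleteSpace K]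
  {φ : A →CP (H →L[ℂ] H)} {π : A →⋆ₐ[ℂ] (K →L[ℂ] K)} {V : H →L[ℂ] K}

lemma IsMinimalStinespring.denseRange_orbitMap (hV : IsMinimalStinespring φ π V) :
    DenseRange (orbitMap π V) := by
  have h : Submodule.span ℂ {x : K | ∃ (a : A) (h : H), x = π a (V h)} ≤
      LinearMap.range (orbitMap π V) := by
    rw [Submodule.span_le]
    rintro _ ⟨a, x, rfl⟩
    exact ⟨Finsupp.single a x, orbitMap_single π V a x⟩
  have h2 := Submodule.topologicalClosure_mono h
  rw [hV.minimal, top_le_iff, ← Submodule.dense_iff_topologicalClosure_eq_top] at h2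
  exact h2

lemma IsMinimalStinespring.adjoint_comp_self (hV : IsMinimalStinespring φ π V)
    (hφ : φ ∈ generalizedStateSpace A H) : V.adjoint ∘L V = 1 := by
  have h1 : φ 1 = 1 := hφ
  rw [← h1, hV.dilation 1, map_one]
  rfl

lemma CompletelyPositiveMap.re_kernelForm_conj_nonneg (ψ : A →CP (H →L[ℂ] H)) (T : H →L[ℂ] H)
    (f : A →₀ H) : 0 ≤ (kernelForm (fun a => star T * ψ a * T) f f).re := by
  have h := ψ.re_sum_inner_nonneg (n := f.support) (fun a => a) (fun a => T (f a))
  have h2 : kernelForm (fun a => star T * ψ a * T) f f =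
      ∑ i : f.support, ∑ j : f.support, ⟪T (f i), ψ (star (i : A) * j) (T (f j))⟫_ℂ := by
    simp only [kernelForm, Finsupp.sum, mul_apply_eq_comp, ContinuousLinearMap.star_eq_adjoint,
      ContinuousLinearMap.adjoint_inner_right]
    rw [← Finset.sum_coe_sort f.support]
    exact Finset.sum_congr rfl fun i _ => (Finset.sum_coe_sort f.support
      fun j => ⟪T (f i), ψ (star (i : A) * j) (T (f j))⟫_ℂ).symm
  rw [h2]
  exact h

end Stinespring

lemma exists_sqrt_mem_repCommutant {A : Type*} [CStarAlgebra A]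
    {K : Type*} [NormedAddCommGroup K] [InnerProductSpace ℂ K] [CompleteSpace K]
    {π : A →⋆ₐ[ℂ] (K →L[ℂ] K)} {D : K →L[ℂ] K} (hD : D ∈ repCommutant π) (hpos : 0 ≤ D) :
    ∃ B ∈ repCommutant π, star B = B ∧ B * B = D := by
  refine ⟨CFC.sqrt D, ?_, (IsSelfAdjoint.of_nonneg (CFC.sqrt_nonneg D)).star_eq,
    CFC.sqrt_mul_sqrt_self D hpos⟩
  rw [repCommutant, Set.mem_centralizer_iff, Set.forall_mem_range] at hD ⊢
  intro a
  have h : Commute D (π a) := (hD a).symm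
  exact (h.cfcₙ_nnreal NNReal.sqrt).symm.eq

lemma mem_unitary_of_isUnit_of_star_mul_self {M : Type*} [Monoid M] [StarMul M] {u : M}
    (hu : IsUnit u) (h : star u * u = 1) : u ∈ unitary M := by
  obtain ⟨v, hv⟩ := hu
  have hs : star u = ↑v⁻¹ := by
    rw [← hv] at h ⊢
    rw [← mul_one (star (v : M)), ← v.mul_inv, ← mul_assoc, h, one_mul]
  refine Unitary.mem_iff.mpr ⟨h, ?_⟩
  rw [hs, ← hv, v.mul_inv]

lemma eq_conj_mul_inv_of_conj_eq {M : Type*} [Monoid M] [StarMul M] {t : Mˣ} {r p q : M}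
    (h : star (t : M) * p * t = star r * q * r) : p = star (r * ↑t⁻¹) * q * (r * ↑t⁻¹) := by
  have h1 : star (↑t⁻¹ : M) * (star (t : M) * p * t) * ↑t⁻¹ = p := by
    have h2 : star (↑t⁻¹ : M) * star (t : M) = 1 := by
      rw [← star_mul, t.mul_inv, star_one]
    rw [← mul_assoc, ← mul_assoc, h2, one_mul, mul_assoc, t.mul_inv, mul_one]
  rw [← h1, h, star_mul]
  simp only [mul_assoc]

section Main

variable {A : Type*} [CStarAlgebra A] [PartialOrder A] [StarOrderedRing A]
  {H : Type*} [NormedAddCommGroup H] [InnerProductSpace ℂ H] [CompleteSpace H]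
  {K : Type*} [NormedAddCommGroup K] [InnerProductSpace ℂ K] [CompleteSpace K]
  {φ : A →CP (H →L[ℂ] H)} {π : A →⋆ₐ[ℂ] (K →L[ℂ] K)} {V : H →L[ℂ] K}

/-- Every proper C⋆-convex summand of `φ` is a compression by an element of the commutant. -/
lemma IsProperCStarConvexCombination.exists_mem_repCommutant (hV : IsMinimalStinespring φ π V)
    {n : ℕ} {T : Fin n → (H →L[ℂ] H)} {ψ : Fin n → (A →CP (H →L[ℂ] H))}
    (h : IsProperCStarConvexCombination φ T ψ) (i : Fin n) :
    ∃ D ∈ repCommutant π, D.IsPositive ∧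
      ∀ a, star (T i) * ψ i a * T i = V.adjoint ∘L D ∘L π a ∘L V := by
  refine exists_mem_repCommutant_of_kernelForm_le hV.denseRange_orbitMap (fun a => ?_)
    (fun f => (ψ i).re_kernelForm_conj_nonneg (T i) f) fun f => ?_
  · rw [← ContinuousLinearMap.star_eq_adjoint, star_mul, star_mul, star_star, ← map_star, mul_assoc]
  · have hsum : (kernelForm (fun a => V.adjoint ∘L π a ∘L V) f f).re =
        ∑ j, (kernelForm (fun a => star (T j) * ψ j a * T j) f f).re := by
      rw [← Complex.re_sum, ← kernelForm_sum]
      congr 2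
      ext1 a
      rw [← hV.dilation, h.eq_sum]
    rw [kernelForm_compression] at hsum
    have hnorm : ‖orbitMap π V f‖ ^ 2 = (⟪orbitMap π V f, orbitMap π V f⟫_ℂ).re :=
      (inner_self_eq_norm_sq (𝕜 := ℂ) _).symm
    rw [hnorm, hsum]
    exact Finset.single_le_sum (f := fun j => (kernelForm (fun a => star (T j) * ψ j a * T j) f f).re)
      (fun j _ => (ψ j).re_kernelForm_conj_nonneg (T j) f) (Finset.mem_univ i)

lemma isUnitarilyEquivalentTo_of_conj_eq {ψ φ : A →CP (H →L[ℂ] H)}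
    (hψ : ψ ∈ generalizedStateSpace A H) (hφ : φ ∈ generalizedStateSpace A H) {T R : H →L[ℂ] H}
    (hT : IsUnit T) (hR : IsUnit R) (h : ∀ a, star T * ψ a * T = star R * φ a * R) :
    IsUnitarilyEquivalentTo ψ φ := by
  have hψ1 : ψ 1 = 1 := hψ
  have hφ1 : φ 1 = 1 := hφ
  obtain ⟨t, rfl⟩ := hT
  obtain ⟨U, hU⟩ : ∃ U, U = R * ↑t⁻¹ := ⟨_, rfl⟩
  have hUu : IsUnit U := hU ▸ hR.mul t⁻¹.isUnit
  have hconj : ∀ a, ψ a = star U * φ a * U := fun a => by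
    rw [hU]
    exact eq_conj_mul_inv_of_conj_eq (h a)
  have h1 := hconj 1
  rw [hψ1, hφ1, mul_one] at h1
  exact ⟨U, mem_unitary_of_isUnit_of_star_mul_self hUu h1.symm, hconj⟩

lemma isCStarExtreme_of_factorization (hφ : φ ∈ generalizedStateSpace A H)
    (hV : IsMinimalStinespring φ π V)
    (hfac : ∀ D ∈ repCommutant π, D.IsPositive → IsUnit (V.adjoint ∘L D ∘L V) →
      ∃ S ∈ repCommutant π, D = S.adjoint ∘L S ∧
        S ∘L V ∘L V.adjoint = V ∘L V.adjoint ∘L S ∘L V ∘L V.adjoint ∧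
        IsUnit (V.adjoint ∘L S ∘L V)) : IsCStarExtreme φ := by
  refine ⟨hφ, fun n T ψ h i => ?_⟩
  have hVVx : ∀ x, V.adjoint (V x) = x := fun x =>
    congrArg (fun L => L x) (hV.adjoint_comp_self hφ)
  obtain ⟨D, hD, hDpos, hDψ⟩ := h.exists_mem_repCommutant hV i
  have hψ1 : ψ i 1 = 1 := h.ucp i
  have hDV : V.adjoint ∘L D ∘L V = star (T i) * T i := by
    have h1 := hDψ 1
    rw [hψ1, mul_one, map_one] at h1
    rw [h1]
    ext x
    simp
  obtain ⟨S, hS, hDS, hSV, hSu⟩ := hfac D hD hDpos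
    (hDV ▸ (h.invertible i).star.mul (h.invertible i))
  have hSVx : ∀ x, S (V x) = V (V.adjoint (S (V x))) := by
    intro x
    have := congrArg (fun L => L (V x)) hSV
    simpa [hVVx] using this
  refine isUnitarilyEquivalentTo_of_conj_eq (h.ucp i) hφ (h.invertible i) hSu fun a => ?_
  rw [hDψ, hDS]
  ext y
  refine ext_inner_left ℂ fun x => ?_
  have hS' := mem_repCommutant_iff.mp hS
  simp only [hV.dilation, ContinuousLinearMap.comp_apply, mul_apply_eq_comp,
    ContinuousLinearMap.star_eq_adjoint, ContinuousLinearMap.adjoint_inner_right]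
  rw [← hSVx, ← hSVx, hS']

/-- The normalized compression attached to a positive element of the commutant. -/
lemma exists_normalized_compression {B : K →L[ℂ] K} (hB : B ∈ repCommutant π) (hBs : star B = B)
    (hu : IsUnit (V.adjoint ∘L (B * B) ∘L V)) :
    ∃ (T : H →L[ℂ] H) (R : H →L[ℂ] K), IsUnit T ∧ R ∘L T = B ∘L V ∧
      compressionCP π R ∈ generalizedStateSpace A H ∧
      ∀ a, star T * compressionCP π R a * T = V.adjoint ∘L (B * B) ∘L π a ∘L V := by
  have hBad : B.adjoint = B := hBs
  have hQ : V.adjoint ∘L (B * B) ∘L V = (B ∘L V).adjoint ∘L (B ∘L V) := by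
    rw [ContinuousLinearMap.adjoint_comp, hBad]
    rfl
  have hQ0 : 0 ≤ V.adjoint ∘L (B * B) ∘L V := by
    rw [hQ, ContinuousLinearMap.nonneg_iff_isPositive]
    exact ContinuousLinearMap.isPositive_adjoint_comp_self _
  obtain ⟨t, ht⟩ := (CFC.isUnit_sqrt_iff _ hQ0).mpr hu
  have hts : star (t : H →L[ℂ] H) = t := by
    rw [ht]
    exact (IsSelfAdjoint.of_nonneg (CFC.sqrt_nonneg _)).star_eq
  have htt : (t : H →L[ℂ] H) * t = V.adjoint ∘L (B * B) ∘L V := by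
    rw [ht, CFC.sqrt_mul_sqrt_self _ hQ0]
  have hRT : (B ∘L V ∘L (↑t⁻¹ : H →L[ℂ] H)) ∘L (t : H →L[ℂ] H) = B ∘L V := by
    have : (↑t⁻¹ : H →L[ℂ] H) ∘L (t : H →L[ℂ] H) = ContinuousLinearMap.id ℂ H := t.inv_mul
    rw [ContinuousLinearMap.comp_assoc, ContinuousLinearMap.comp_assoc, this,
      ContinuousLinearMap.comp_id]
  have hcomp : ∀ a, star (t : H →L[ℂ] H) * compressionCP π (B ∘L V ∘L (↑t⁻¹ : H →L[ℂ] H)) a * t =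
      V.adjoint ∘L (B * B) ∘L π a ∘L V := by
    intro a
    have h1 : star (t : H →L[ℂ] H) * compressionCP π (B ∘L V ∘L (↑t⁻¹ : H →L[ℂ] H)) a * t =
        ((B ∘L V ∘L (↑t⁻¹ : H →L[ℂ] H)) ∘L (t : H →L[ℂ] H)).adjoint ∘L π a ∘L
        ((B ∘L V ∘L (↑t⁻¹ : H →L[ℂ] H)) ∘L (t : H →L[ℂ] H)) := by
      rw [ContinuousLinearMap.adjoint_comp]
      rfl
    rw [h1, hRT, ContinuousLinearMap.adjoint_comp, hBad]
    ext x
    simp [mem_repCommutant_iff.mp hB]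
  refine ⟨t, _, t.isUnit, hRT, ?_, hcomp⟩
  have h1 := hcomp 1
  rw [map_one π] at h1
  have h2 : star (t : H →L[ℂ] H) * compressionCP π (B ∘L V ∘L (↑t⁻¹ : H →L[ℂ] H)) 1 * t =
      star (t : H →L[ℂ] H) * 1 * t := by
    rw [h1, mul_one, hts, htt]
    rfl
  rw [t.mul_left_inj, hts, t.mul_right_inj] at h2
  exact h2

lemma IsCStarExtreme.exists_factorization_of_le (hext : IsCStarExtreme φ)
    (hV : IsMinimalStinespring φ π V) {D : K →L[ℂ] K} (hD : D ∈ repCommutant π) (hpos : 0 ≤ D)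
    (hle : D ≤ 1) (hu : IsUnit (V.adjoint ∘L D ∘L V))
    (hu' : IsUnit (V.adjoint ∘L (1 - D) ∘L V)) :
    ∃ S ∈ repCommutant π, D = S.adjoint ∘L S ∧ (∀ x, S (V x) = V (V.adjoint (S (V x)))) ∧
      IsUnit (V.adjoint ∘L S ∘L V) := by
  have hVVx : ∀ x, V.adjoint (V x) = x := fun x =>
    congrArg (fun L => L x) (hV.adjoint_comp_self hext.1)
  have hD' : 1 - D ∈ repCommutant π := by
    rw [mem_repCommutant_iff] at hD ⊢
    intro a x
    simp [hD]
  obtain ⟨B, hB, hBs, rfl⟩ := exists_sqrt_mem_repCommutant hD hpos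
  obtain ⟨C, hC, hCs, hCC⟩ := exists_sqrt_mem_repCommutant hD' (sub_nonneg.mpr hle)
  rw [← hCC] at hu'
  obtain ⟨T₁, R₁, hT₁, hRT₁, hucp₁, hcomp₁⟩ := exists_normalized_compression (A := A) hB hBs hu
  obtain ⟨T₂, R₂, hT₂, -, hucp₂, hcomp₂⟩ := exists_normalized_compression (A := A) hC hCs hu'
  have hsum : ∀ a, φ a = star T₁ * compressionCP π R₁ a * T₁ +
      star T₂ * compressionCP π R₂ a * T₂ := by
    intro a
    rw [hcomp₁, hcomp₂, hCC, hV.dilation]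
    ext x
    simp
  have hconv : IsProperCStarConvexCombination φ ![T₁, T₂]
      ![compressionCP π R₁, compressionCP π R₂] := by
    refine ⟨fun i => ?_, fun i => ?_, ?_, fun a => ?_⟩
    · fin_cases i
      exacts [hucp₁, hucp₂]
    · fin_cases i
      exacts [hT₁, hT₂]
    · have h1 := hsum 1
      rw [show φ 1 = 1 from hext.1, show compressionCP π R₁ 1 = 1 from hucp₁,
        show compressionCP π R₂ 1 = 1 from hucp₂, mul_one, mul_one] at h1
      rw [Fin.sum_univ_two]
      exact h1.symm
    · rw [Fin.sum_univ_two]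
      exact hsum a
  obtain ⟨U, hU, hUψ⟩ := hext.2 2 _ _ hconv 0
  have hUunit : IsUnit U := ⟨Unitary.toUnits ⟨U, hU⟩, rfl⟩
  obtain ⟨X, hX, hXX, hXW⟩ := exists_isometry_mem_repCommutant (π := π) (W := V ∘L U) (R := R₁)
    (hV.denseRange_orbitMap.orbitMap_comp hUunit) (fun a => by
      refine (hUψ a).trans ?_
      rw [hV.dilation, ContinuousLinearMap.adjoint_comp]
      rfl)
  have hBV : ∀ x, B (V x) = X (V (U (T₁ x))) := by
    intro x
    have h1 := congrArg (fun L => L x) hRT₁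
    rw [← hXW] at h1
    exact h1.symm
  have hSV : ∀ x, X.adjoint (B (V x)) = V (U (T₁ x)) := by
    intro x
    rw [hBV, hXX]
  have hXa : X.adjoint ∈ repCommutant π := star_mem_repCommutant hX
  have hB' := mem_repCommutant_iff.mp hB
  have hX' := mem_repCommutant_iff.mp hX
  have hXa' := mem_repCommutant_iff.mp hXa
  have hproj : ∀ y, X (X.adjoint (B y)) = B y := by
    have : X ∘L X.adjoint ∘L B = B := by
      refine ContinuousLinearMap.ext_of_denseRange_orbitMap hV.denseRange_orbitMap fun a x => ?_
      simp only [ContinuousLinearMap.comp_apply]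
      rw [← hB', hBV, hX', hXX]
    exact fun y => congrArg (fun L => L y) this
  refine ⟨X.adjoint ∘L B, ?_, ?_, fun x => ?_, ?_⟩
  · rw [mem_repCommutant_iff]
    intro a x
    simp only [ContinuousLinearMap.comp_apply, hXa', hB']
  · ext x
    rw [ContinuousLinearMap.adjoint_comp, ContinuousLinearMap.adjoint_adjoint,
      show B.adjoint = B from hBs]
    simp [hproj]
  · simp only [ContinuousLinearMap.comp_apply, hSV, hVVx]
  · have : V.adjoint ∘L (X.adjoint ∘L B) ∘L V = U * T₁ := by
      ext x
      simp [hSV, hVVx]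
    rw [this]
    exact hUunit.mul hT₁

lemma IsCStarExtreme.exists_factorization (hext : IsCStarExtreme φ)
    (hV : IsMinimalStinespring φ π V) {D : K →L[ℂ] K} (hD : D ∈ repCommutant π)
    (hpos : D.IsPositive) (hu : IsUnit (V.adjoint ∘L D ∘L V)) :
    ∃ S ∈ repCommutant π, D = S.adjoint ∘L S ∧
      S ∘L V ∘L V.adjoint = V ∘L V.adjoint ∘L S ∘L V ∘L V.adjoint ∧
      IsUnit (V.adjoint ∘L S ∘L V) := by
  have hVVx : ∀ x, V.adjoint (V x) = x := fun x =>
    congrArg (fun L => L x) (hV.adjoint_comp_self hext.1)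
  let r : ℝ := ‖D‖ + 1
  have hr : 0 < r := by positivity
  have hr' : (r : ℂ) ≠ 0 := by exact_mod_cast hr.ne'
  have hD₁ : ((r : ℂ)⁻¹ • D) ∈ repCommutant π := by
    rw [mem_repCommutant_iff] at hD ⊢
    intro a x
    simp [hD]
  have hnorm : ‖(r : ℂ)⁻¹ • D‖ < 1 := by
    rw [norm_smul, norm_inv, Complex.norm_real, Real.norm_of_nonneg hr.le, inv_mul_lt_one₀ hr]
    exact lt_add_one _
  have hpos₁ : 0 ≤ (r : ℂ)⁻¹ • D := by
    rw [ContinuousLinearMap.nonneg_iff_isPositive]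
    refine hpos.smul_of_nonneg ?_
    rw [← Complex.ofReal_inv]
    exact Complex.zero_le_real.mpr (by positivity)
  have hle₁ : (r : ℂ)⁻¹ • D ≤ 1 := (CStarAlgebra.norm_le_one_iff_of_nonneg _ hpos₁).mp hnorm.le
  have hu₁ : IsUnit (V.adjoint ∘L ((r : ℂ)⁻¹ • D) ∘L V) := by
    have : V.adjoint ∘L ((r : ℂ)⁻¹ • D) ∘L V = (Units.mk0 _ (inv_ne_zero hr')) •
        (V.adjoint ∘L D ∘L V) := by
      ext x
      simp [Units.smul_def]
    rw [this]
    exact hu.smul _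
  have hVnorm : ‖V‖ ≤ 1 := by
    refine V.opNorm_le_bound zero_le_one fun x => ?_
    rw [one_mul, ← sq_le_sq₀ (norm_nonneg _) (norm_nonneg _), ← inner_self_eq_norm_sq (𝕜 := ℂ),
      ← ContinuousLinearMap.adjoint_inner_right, hVVx, inner_self_eq_norm_sq]
  have hu₂ : IsUnit (V.adjoint ∘L (1 - (r : ℂ)⁻¹ • D) ∘L V) := by
    have : V.adjoint ∘L (1 - (r : ℂ)⁻¹ • D) ∘L V = 1 - V.adjoint ∘L ((r : ℂ)⁻¹ • D) ∘L V := by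
      ext x
      simp [hVVx]
    rw [this]
    refine isUnit_one_sub_of_norm_lt_one (lt_of_le_of_lt ?_ hnorm)
    calc ‖V.adjoint ∘L ((r : ℂ)⁻¹ • D) ∘L V‖ ≤ ‖V.adjoint‖ * (‖(r : ℂ)⁻¹ • D‖ * ‖V‖) :=
          (ContinuousLinearMap.opNorm_comp_le _ _).trans
            (mul_le_mul_of_nonneg_left (ContinuousLinearMap.opNorm_comp_le _ _) (norm_nonneg _))
      _ ≤ 1 * (‖(r : ℂ)⁻¹ • D‖ * 1) := by
          rw [LinearIsometryEquiv.norm_map]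
          gcongr
      _ = ‖(r : ℂ)⁻¹ • D‖ := by ring
  obtain ⟨S, hS, hDS, hSV, hSu⟩ := hext.exists_factorization_of_le hV hD₁ hpos₁ hle₁ hu₁ hu₂
  have hs' : ((√r : ℝ) : ℂ) ≠ 0 := by exact_mod_cast (Real.sqrt_pos.mpr hr).ne'
  have hss : ((√r : ℝ) : ℂ) * ((√r : ℝ) : ℂ) = r := by
    rw [← Complex.ofReal_mul, Real.mul_self_sqrt hr.le]
  refine ⟨((√r : ℝ) : ℂ) • S, ?_, ?_, ?_, ?_⟩
  · rw [mem_repCommutant_iff] at hS ⊢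
    intro a x
    simp [hS]
  · rw [map_smulₛₗ, ContinuousLinearMap.smul_comp, ContinuousLinearMap.comp_smul, smul_smul,
      Complex.conj_ofReal, hss, ← hDS, smul_smul, mul_inv_cancel₀ hr', one_smul]
  · ext x
    simp only [ContinuousLinearMap.comp_apply, _root_.smul_apply, map_smul, ← hSV]
  · have : V.adjoint ∘L (((√r : ℝ) : ℂ) • S) ∘L V = (Units.mk0 _ hs') •
        (V.adjoint ∘L S ∘L V) := by
      ext x
      simp [Units.smul_def]
    rw [this]
    exact hSu.smul _

lemma isInvertibleOn_range_iff (hVV : V.adjoint ∘L V = 1) (S : K →L[ℂ] K) :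
    (S ∘L V ∘L V.adjoint = V ∘L V.adjoint ∘L S ∘L V ∘L V.adjoint ∧
      IsUnit (V.adjoint ∘L S ∘L V)) ↔ IsInvertibleOn S V.range := by
  have hVVx : ∀ x, V.adjoint (V x) = x := fun x => congrArg (fun L => L x) hVV
  have hinv : S ∘L V ∘L V.adjoint = V ∘L V.adjoint ∘L S ∘L V ∘L V.adjoint ↔
      ∀ x ∈ V.range, S x ∈ V.range := by
    constructor
    · rintro h _ ⟨x, rfl⟩
      have h1 := congrArg (fun L => L (V x)) h
      simp only [ContinuousLinearMap.comp_apply, hVVx] at h1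
      exact ⟨_, h1.symm⟩
    · intro h
      ext x
      obtain ⟨y, hy⟩ := h (V (V.adjoint x)) ⟨_, rfl⟩
      have hy' : V y = S (V (V.adjoint x)) := hy
      simp only [ContinuousLinearMap.comp_apply]
      rw [← hy', hVVx]
  let e : H ≃L[ℂ] V.range := ContinuousLinearEquiv.equivOfInverse
    (V.codRestrict V.range fun x => ⟨x, rfl⟩) (V.adjoint ∘L V.range.subtypeL) (fun x => hVVx x) (by
      rintro ⟨_, ⟨x, rfl⟩⟩
      ext
      exact congrArg V (hVVx x))
  rw [IsInvertibleOn, hinv, ← exists_prop]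
  refine exists_congr fun h => ?_
  rw [← MulEquiv.isUnit_map e.conjContinuousAlgEquiv]
  have : e.conjContinuousAlgEquiv (V.adjoint ∘L S ∘L V) =
      (S ∘L V.range.subtypeL).codRestrict V.range fun x => h x x.2 := by
    ext ⟨_, ⟨x, rfl⟩⟩
    obtain ⟨y, hy⟩ := h (V x) ⟨_, rfl⟩
    have hy' : V y = S (V x) := hy
    change V (V.adjoint (S (V (V.adjoint (V x))))) = S (V x)
    rw [hVVx, ← hy', hVVx]
  rw [this]

end Main

theorem mainTheorem6
    {A : Type*} [CStarAlgebra A] [PartialOrder A] [StarOrderedRing A]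
    {H : Type*} [NormedAddCommGroup H] [InnerProductSpace ℂ H] [CompleteSpace H]
    {K : Type*} [NormedAddCommGroup K] [InnerProductSpace ℂ K] [CompleteSpace K]
    (φ : A →CP (H →L[ℂ] H)) (hφ : φ ∈ generalizedStateSpace A H)
    (π : A →⋆ₐ[ℂ] (K →L[ℂ] K)) (V : H →L[ℂ] K) (hV : IsMinimalStinespring φ π V) :
    (IsCStarExtreme φ ↔
      ∀ D ∈ repCommutant π, D.IsPositive → IsUnit (V.adjoint ∘L D ∘L V) →
        ∃ S ∈ repCommutant π, D = S.adjoint ∘L S ∧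
          S ∘L V ∘L V.adjoint = V ∘L V.adjoint ∘L S ∘L V ∘L V.adjoint ∧
          IsUnit (V.adjoint ∘L S ∘L V)) ∧
    (∀ S ∈ repCommutant π,
      (S ∘L V ∘L V.adjoint = V ∘L V.adjoint ∘L S ∘L V ∘L V.adjoint ∧
        IsUnit (V.adjoint ∘L S ∘L V)) ↔
      IsInvertibleOn S V.range) := by
  refine ⟨⟨fun h D hD hpos hu => h.exists_factorization hV hD hpos hu,
    isCStarExtreme_of_factorization hφ hV⟩, fun S _ => ?_⟩
  exact isInvertibleOn_range_iff (hV.adjoint_comp_self hφ) S
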